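/- A spherical code is a finite set $C$ of points of the unit sphere $\mathbb{S}^{n-1}\subset\mathbb{R}^n$; it is antipodal if $C=-C$. Write $I(C)=\{\langle x,y\rangle : x,y\in C,\ x\neq y\}$ and, for $x\in C$ and $t\in\mathbb{R}$, $A_t(x)=|\{y\in C : \langle x,y\rangle=t\}|$. The code $C$ is distance invariant if, for every $t\in I(C)$, the number $A_t(x)$ does not depend on $x\in C$; it is then written $A_t$. The code $C$ is a spherical $\tau$-design if \[\int_{\mathbb{S}^{n-1}}p\,d\sigma_n=\frac1{|C|}\sum_{x\in C}p(x)\] for every real polynomial $p(x_1,\dots,x_n)$ of total degree at most $\tau$, where $\sigma_n$ is the normalized surface measure. Theorem. Let $C\subset\mathbb{S}^{47}$ be a spherical code such that \[I(C)\subset\left[-1,\tfrac12\right]\setminus\left(\left(-\tfrac13,-\tfrac16\right)\cup\left(\tfrac16,\tfrac13\right)\right),\] and suppose that $C$ is antipodal or a spherical $3$-design. Then $|C|\le 52\,416\,000$. If $|C|=52\,416\,000$, then $C$ is an antipodal spherical $11$-design, it is distance invariant, $I(C)=\{-1,\pm\frac12,\pm\frac13,\pm\frac16,0\}$, and its distance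 distribution is \[A_{-1}=1,\quad A_{1/2}=A_{-1/2}=36\,848,\quad A_{1/3}=A_{-1/3}=1\,678\,887,\quad A_{1/6}=A_{-1/6}=12\,608\,784,\quad A_0=23\,766\,960.\] -/

import Mathlib

open MeasureTheory
open scoped Pointwise

/-- A finite set of points of `ℝⁿ` is a spherical code if all its points have norm one. -/
def IsSphericalCode {n : ℕ} (C : Finset (EuclideanSpace ℝ (Fin n))) : Prop :=
  (C : Set (EuclideanSpace ℝ (Fin n))) ⊆ Metric.sphere 0 1

/-- `C = -C`. -/
def IsAntipodalCode {n : ℕ} (C : Finset (EuclideanSpace ℝ (Fin n))) : Prop :=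
  (C : Set (EuclideanSpace ℝ (Fin n))) = -(C : Set (EuclideanSpace ℝ (Fin n)))

/-- The set `I(C)` of inner products of distinct points of `C`. -/
def innerProductSet {n : ℕ} (C : Finset (EuclideanSpace ℝ (Fin n))) : Set ℝ :=
  {t : ℝ | ∃ x ∈ C, ∃ y ∈ C, x ≠ y ∧ inner ℝ x y = t}

/-- `C` is a spherical `τ`-design: it is a spherical code, and for every real polynomial of total
degree at most `τ` the mean over the unit sphere (with respect to the surface measure) equals the
mean over `C`. -/
def IsSphericalDesign {n : ℕ} (τ : ℕ) (C : Finset (EuclideanSpace ℝ (Fin n))) : Prop :=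
  IsSphericalCode C ∧
    ∀ p : MvPolynomial (Fin n) ℝ, p.totalDegree ≤ τ →
      ⨍ x : Metric.sphere (0 : EuclideanSpace ℝ (Fin n)) 1,
          MvPolynomial.eval (fun i => (x : EuclideanSpace ℝ (Fin n)) i) p
          ∂((volume : Measure (EuclideanSpace ℝ (Fin n))).toSphere)
        = (1 / (C.card : ℝ)) * ∑ x ∈ C, MvPolynomial.eval (fun i => x i) p

/-- `A_t(x)`: the number of points of `C` having inner product `t` with `x`. -/
noncomputable def distanceCount {n : ℕ} (C : Finset (EuclideanSpace ℝ (Fin n)))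
    (x : EuclideanSpace ℝ (Fin n)) (t : ℝ) : ℕ :=
  (C.filter (fun y => inner ℝ x y = t)).card

/-- The distance distribution of `C` with respect to `x ∈ C` does not depend on `x`. -/
def IsDistanceInvariant {n : ℕ} (C : Finset (EuclideanSpace ℝ (Fin n))) : Prop :=
  ∀ x ∈ C, ∀ y ∈ C, ∀ t ∈ innerProductSet C, distanceCount C x t = distanceCount C y t

/-- `[-1, 1/2]` without `(-1/3, -1/6) ∪ (1/6, 1/3)`. -/
def allowedInnerProducts : Set ℝ :=
  Set.Icc (-1) (1 / 2) \ (Set.Ioo (-1 / 3) (-1 / 6) ∪ Set.Ioo (1 / 6) (1 / 3))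

/-! This is Delsarte's linear programming bound with equality analysis. In the Fischer inner product
the zonal harmonics satisfy `[Z_x, Z_y] = k! G_k(⟨x,y⟩)`, so the double sum `S_k = ∑ G_k(⟨x,y⟩)`
over `C` is `1/k!` times the squared norm of `∑ Z_x`. Hence `S_k ≥ 0`, and `S_k = 0` forces `∑ Z_x =
0` as a polynomial, so that `∑ G_k(⟨x,y⟩)` over `x ∈ C` vanishes for every unit vector `y`.

`lpPoly` has degree 11 and is nonpositive at all allowed inner products. Its Gegenbauer coefficients
are positive except in degree 3, where the hypothesis on `C` gives `S_3 = 0`. Summing `lpPoly` over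
all pairs bounds `|C|` by `lpPoly 1` over the constant coefficient.

At equality `S_1, …, S_11` vanish and every inner product is a root of `lpPoly`. The first fact
makes the power sums up to degree 11 independent of direction, hence equal to the moments of the
sphere, and powers of linear forms detect designs. With the second, the counts at the eight roots
solve an invertible linear system. Antipodality follows from `A_{-1} = 1`. -/

/-! ### Fischer inner product and Laplacian on polynomials -/

section Fischer

open MvPolynomial

variable {σ : Type*} [Fintype σ]

/-- The Fischer inner product `[p, q] = ∑ α, α! pₐ qₐ` on real polynomials. -/
noncomputable def fischer : MvPolynomial σ ℝ →ₗ[ℝ] MvPolynomial σ ℝ →ₗ[ℝ] ℝ :=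
  (basisMonomials σ ℝ).constr ℝ
    (fun α => (∏ i, ((α i).factorial : ℝ)) • lcoeff ℝ α)

lemma fischer_monomial (α : σ →₀ ℕ) (a : ℝ) (q : MvPolynomial σ ℝ) :
    fischer (monomial α a) q = a * ((∏ i, ((α i).factorial : ℝ)) * coeff α q) := by
  have h : monomial α a = a • (basisMonomials σ ℝ) α := by
    simp [smul_monomial]
  rw [h, map_smul, fischer, Module.Basis.constr_basis]
  simp

/-- The weight `α!` is chosen for this adjunction: raising `α i` by one multiplies it by `α i + 1`,
the factor produced by differentiation. -/
lemma fischer_X_mul (i : σ) (p q : MvPolynomial σ ℝ) :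
    fischer (X i * p) q = fischer p (pderiv i q) := by
  classical
  induction p using MvPolynomial.induction_on' with
  | monomial α a =>
    rw [X, monomial_mul, fischer_monomial, fischer_monomial, coeff_pderiv, one_mul, add_comm]
    have h : ∏ j, (((α + Finsupp.single i 1 : σ →₀ ℕ) j).factorial : ℝ)
        = (α i + 1) * ∏ j, ((α j).factorial : ℝ) := by
      rw [← Finset.mul_prod_erase _ _ (Finset.mem_univ i),
        ← Finset.mul_prod_erase _ (fun j => ((α j).factorial : ℝ)) (Finset.mem_univ i),
        ← mul_assoc]
      congr 1
      · simp [Nat.factorial_succ]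
      · refine Finset.prod_congr rfl fun j hj => ?_
        simp [(Finset.ne_of_mem_erase hj).symm]
    rw [h]
    ring
  | add p p' hp hp' => simp only [mul_add, map_add, LinearMap.add_apply, hp, hp']

lemma fischer_self (p : MvPolynomial σ ℝ) :
    fischer p p = ∑ α ∈ p.support, (∏ i, ((α i).factorial : ℝ)) * coeff α p ^ 2 := by
  conv_lhs => enter [1]; rw [p.as_sum]
  rw [map_sum, LinearMap.sum_apply]
  refine Finset.sum_congr rfl fun α _ => ?_
  rw [fischer_monomial]
  ring

lemma fischer_self_nonneg (p : MvPolynomial σ ℝ) : 0 ≤ fischer p p := by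
  rw [fischer_self]
  positivity

lemma eq_zero_of_fischer_self_eq_zero {p : MvPolynomial σ ℝ} (h : fischer p p = 0) : p = 0 := by
  rw [fischer_self, Finset.sum_eq_zero_iff_of_nonneg (fun _ _ => by positivity)] at h
  ext α
  by_contra hα
  have h0 := h α (by simpa using hα)
  have h1 : (∏ i, ((α i).factorial : ℝ)) ≠ 0 :=
    Finset.prod_ne_zero_iff.2 fun i _ => by positivity
  simp [h1] at h0
  simp [h0] at hα

/-- The linear form `⟨x, ·⟩`. -/
noncomputable def linForm (x : σ → ℝ) : MvPolynomial σ ℝ := ∑ i, C (x i) * X i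

/-- The quadratic form `‖·‖²`. -/
noncomputable def normSqForm (σ : Type*) [Fintype σ] : MvPolynomial σ ℝ := ∑ i, X i ^ 2

/-- The Laplace operator on polynomials. -/
noncomputable def polyLaplacian : MvPolynomial σ ℝ →ₗ[ℝ] MvPolynomial σ ℝ :=
  ∑ i, (pderiv i).toLinearMap ∘ₗ (pderiv i).toLinearMap

lemma polyLaplacian_apply (p : MvPolynomial σ ℝ) :
    polyLaplacian p = ∑ i, pderiv i (pderiv i p) := by
  simp [polyLaplacian]

lemma isHomogeneous_linForm (x : σ → ℝ) : (linForm x).IsHomogeneous 1 :=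
  IsHomogeneous.sum _ _ _ fun i _ => by simpa using (isHomogeneous_C σ (x i)).mul (isHomogeneous_X ℝ i)

lemma isHomogeneous_normSqForm : (normSqForm σ).IsHomogeneous 2 :=
  IsHomogeneous.sum _ _ _ fun i _ => by simpa using (isHomogeneous_X ℝ i).pow 2

lemma eval_linForm (x y : σ → ℝ) : eval y (linForm x) = ∑ i, x i * y i := by
  simp [linForm]

lemma eval_normSqForm (y : σ → ℝ) : eval y (normSqForm σ) = ∑ i, y i ^ 2 := by
  simp [normSqForm]

lemma pderiv_linForm (x : σ → ℝ) (i : σ) : pderiv i (linForm x) = C (x i) := by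
  classical
  simp [linForm, pderiv_X, Pi.single_apply]

lemma pderiv_normSqForm (i : σ) : pderiv i (normSqForm σ) = 2 * X i := by
  classical
  simp [normSqForm, pderiv_X, Pi.single_apply, Derivation.leibniz_pow]

lemma fischer_linForm_mul (x : σ → ℝ) (p q : MvPolynomial σ ℝ) :
    fischer (linForm x * p) q = fischer p (∑ i, C (x i) * pderiv i q) := by
  simp only [linForm, Finset.sum_mul, map_sum, LinearMap.sum_apply,
    ← smul_eq_C_mul, smul_mul_assoc, map_smul, LinearMap.smul_apply, fischer_X_mul]

lemma fischer_normSqForm_mul (p q : MvPolynomial σ ℝ) :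
    fischer (normSqForm σ * p) q = fischer p (polyLaplacian q) := by
  simp only [normSqForm, polyLaplacian_apply, Finset.sum_mul, map_sum, LinearMap.sum_apply,
    pow_two, mul_assoc, fischer_X_mul]

/-- Powers of linear forms reproduce the values of homogeneous polynomials. -/
lemma fischer_linForm_pow (x : σ → ℝ) (k : ℕ) {q : MvPolynomial σ ℝ} (hq : q.IsHomogeneous k) :
    fischer (linForm x ^ k) q = k.factorial * eval x q := by
  induction k generalizing q with
  | zero =>
    rw [← totalDegree_zero_iff_isHomogeneous, totalDegree_eq_zero_iff_eq_C] at hq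
    rw [hq, pow_zero, ← C_1, C_apply, fischer_monomial]
    simp
  | succ k ih =>
    have hd : (∑ i, C (x i) * pderiv i q).IsHomogeneous k :=
      IsHomogeneous.sum _ _ _ fun i _ => by
        simpa using (isHomogeneous_C σ (x i)).mul (hq.pderiv (i := i))
    rw [pow_succ', fischer_linForm_mul, ih hd]
    have he := congrArg (eval x) hq.sum_X_mul_pderiv
    simp only [map_sum, map_mul, eval_X, eval_C, map_nsmul] at he ⊢
    rw [he, Nat.factorial_succ]
    push_cast
    simp
    ring

/-- Product rule, with Euler-type sums over `i`. Truncated exponents are harmless: the coefficient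
is zero whenever `m < 2` or `j = 0`. -/
lemma polyLaplacian_linForm_pow_mul {x : σ → ℝ} (hx : ∑ i, x i ^ 2 = 1) (m j : ℕ) :
    polyLaplacian (linForm x ^ m * normSqForm σ ^ j)
      = ((m : ℝ) * (m - 1)) • (linForm x ^ (m - 2) * normSqForm σ ^ j)
        + (2 * j * (2 * m + 2 * j - 2 + Fintype.card σ) : ℝ) •
          (linForm x ^ m * normSqForm σ ^ (j - 1)) := by
  have hC : ∑ i, (C (x i) : MvPolynomial σ ℝ) ^ 2 = 1 := by
    rw [← C_1, ← hx]; simp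
  have hl : ∑ i, C (x i) * X i = linForm x := rfl
  have hr : ∑ i, X i ^ 2 = normSqForm σ := rfl
  have key : ∀ i, pderiv i (pderiv i (linForm x ^ m * normSqForm σ ^ j))
      = ((m : MvPolynomial σ ℝ) * ((m - 1 : ℕ) : MvPolynomial σ ℝ) * linForm x ^ (m - 2)
            * normSqForm σ ^ j) * C (x i) ^ 2
        + (4 * (m : MvPolynomial σ ℝ) * (j : MvPolynomial σ ℝ) * linForm x ^ (m - 1)
            * normSqForm σ ^ (j - 1)) * (C (x i) * X i)
        + (4 * (j : MvPolynomial σ ℝ) * ((j - 1 : ℕ) : MvPolynomial σ ℝ) * linForm x ^ m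
            * normSqForm σ ^ (j - 2)) * X i ^ 2
        + 2 * (j : MvPolynomial σ ℝ) * linForm x ^ m * normSqForm σ ^ (j - 1) := by
    intro i
    have h2 : pderiv i (2 : MvPolynomial σ ℝ) = 0 := pderiv_C (a := 2)
    simp only [Derivation.leibniz, Derivation.leibniz_pow, pderiv_linForm, pderiv_normSqForm,
      pderiv_C, pderiv_X_self, map_add, smul_eq_mul, nsmul_eq_mul, Nat.sub_sub, h2]
    norm_num
    ring
  rw [polyLaplacian_apply, Finset.sum_congr rfl fun i _ => key i]
  simp only [Finset.sum_add_distrib, ← Finset.mul_sum, hC, hl, hr, Finset.sum_const,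
    Finset.card_univ, smul_eq_C_mul, nsmul_eq_mul]
  have h1 : (m : MvPolynomial σ ℝ) * linForm x ^ (m - 1) * linForm x = m * linForm x ^ m := by
    rcases m with _ | m <;> simp [pow_succ, mul_assoc]
  have h2 : (j : MvPolynomial σ ℝ) * (j - 1 : ℕ) * normSqForm σ ^ (j - 2) * normSqForm σ
      = j * (j - 1) * normSqForm σ ^ (j - 1) := by
    rcases j with _ | _ | j <;> simp [pow_succ, mul_assoc]
  have h3 : (m : MvPolynomial σ ℝ) * (m - 1 : ℕ) = m * (m - 1) := by
    rcases m with _ | m <;> simp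
  simp only [map_mul, map_add, map_sub, map_natCast, map_ofNat, map_one]
  linear_combination (linForm x ^ (m - 2) * normSqForm σ ^ j) * h3
    + (4 * j * normSqForm σ ^ (j - 1)) * h1 + 4 * linForm x ^ m * h2

end Fischer

/-! ### Gegenbauer polynomials and zonal harmonics -/

/-- The coefficients of the monic Gegenbauer polynomial of degree `k` for the sphere in `ℝⁿ`:
the coefficient of `t ^ (k - 2 * j)` is `gegenbauerCoeff n k j`. -/
noncomputable def gegenbauerCoeff (n k : ℕ) : ℕ → ℝ
  | 0 => 1
  | j + 1 => -(gegenbauerCoeff n k j * (((k : ℝ) - 2 * j) * ((k : ℝ) - 2 * j - 1))) /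
      (2 * ((j : ℝ) + 1) * ((n : ℝ) + 2 * k - 2 * j - 4))

/-- The monic Gegenbauer polynomial of degree `k` for the sphere in `ℝⁿ`. -/
noncomputable def gegenbauer (n k : ℕ) (t : ℝ) : ℝ :=
  ∑ j ∈ Finset.range (k / 2 + 1), gegenbauerCoeff n k j * t ^ (k - 2 * j)

section Zonal

open MvPolynomial

variable {σ : Type*} [Fintype σ]

/-- The zonal harmonic of degree `k` with pole `x`. -/
noncomputable def zonal (k : ℕ) (x : σ → ℝ) : MvPolynomial σ ℝ :=
  ∑ j ∈ Finset.range (k / 2 + 1),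
    gegenbauerCoeff (Fintype.card σ) k j • (linForm x ^ (k - 2 * j) * normSqForm σ ^ j)

lemma eval_zonal (k : ℕ) (x : σ → ℝ) {y : σ → ℝ} (hy : ∑ i, y i ^ 2 = 1) :
    eval y (zonal k x) = gegenbauer (Fintype.card σ) k (∑ i, x i * y i) := by
  simp [zonal, gegenbauer, smul_eval, eval_linForm, eval_normSqForm, hy]

lemma isHomogeneous_zonal (k : ℕ) (x : σ → ℝ) : (zonal k x).IsHomogeneous k := by
  refine IsHomogeneous.sum _ _ _ fun j hj => ?_
  have hj' : 2 * j ≤ k := by have := Finset.mem_range.1 hj; omega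
  have h := ((isHomogeneous_linForm x).pow (k - 2 * j)).mul ((isHomogeneous_normSqForm (σ := σ)).pow j)
  rw [show 1 * (k - 2 * j) + 2 * j = k by omega] at h
  rw [smul_eq_C_mul]
  simpa using (isHomogeneous_C σ _).mul h

/-- The recursion for `gegenbauerCoeff` makes the first Laplacian term at index `j` cancel the
second at index `j + 1`. -/
lemma polyLaplacian_zonal (hσ : 3 ≤ Fintype.card σ) (k : ℕ) {x : σ → ℝ} (hx : ∑ i, x i ^ 2 = 1) :
    polyLaplacian (zonal k x) = 0 := by
  rw [zonal, map_sum]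
  simp only [map_smul, polyLaplacian_linForm_pow_mul hx, smul_add, Finset.sum_add_distrib]
  rw [Finset.sum_range_succ, Finset.sum_range_succ']
  -- The one unpaired term: the last exponent is `0` or `1`.
  have hlast : (((k - 2 * (k / 2) : ℕ) : ℝ) * (((k - 2 * (k / 2) : ℕ) : ℝ) - 1)) = 0 := by
    rcases Nat.mod_two_eq_zero_or_one k with h | h
    · rw [show k - 2 * (k / 2) = 0 by omega]; simp
    · rw [show k - 2 * (k / 2) = 1 by omega]; simp
  rw [hlast]
  simp only [zero_smul, smul_zero, add_zero, Nat.cast_zero, mul_zero, zero_mul]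
  rw [← Finset.sum_add_distrib]
  refine Finset.sum_eq_zero fun j hj => ?_
  have hj' : 2 * (j + 1) ≤ k := by have := Finset.mem_range.1 hj; omega
  have hkj : (2 * ((j : ℝ) + 1)) ≤ k := by exact_mod_cast hj'
  have hn : (3 : ℝ) ≤ Fintype.card σ := by exact_mod_cast hσ
  have hden : ((Fintype.card σ : ℝ) + 2 * k - 2 * j - 4) ≠ 0 := by
    have : (0 : ℝ) ≤ j := j.cast_nonneg
    intro h; linarith
  have hj0 : ((j : ℝ) + 1) ≠ 0 := by positivity
  rw [show k - 2 * j - 2 = k - 2 * (j + 1) by omega, Nat.add_sub_cancel, smul_smul, smul_smul,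
    ← add_smul, gegenbauerCoeff, Nat.cast_sub (show 2 * j ≤ k by omega), Nat.cast_sub hj']
  convert zero_smul ℝ _
  push_cast
  rw [show (2 * ((j : ℝ) + 1) * (2 * ((k : ℝ) - 2 * (j + 1)) + 2 * (j + 1) - 2
      + Fintype.card σ)) = 2 * ((j : ℝ) + 1) * ((Fintype.card σ : ℝ) + 2 * k - 2 * j - 4) by ring,
    div_mul_cancel₀ _ (mul_ne_zero (mul_ne_zero two_ne_zero hj0) hden)]
  ring

lemma exists_zonal_eq (k : ℕ) (x : σ → ℝ) :
    ∃ r, zonal k x = linForm x ^ k + normSqForm σ * r := by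
  refine ⟨∑ j ∈ Finset.range (k / 2), gegenbauerCoeff (Fintype.card σ) k (j + 1) •
    (linForm x ^ (k - 2 * (j + 1)) * normSqForm σ ^ j), ?_⟩
  rw [zonal, Finset.sum_range_succ', add_comm, Finset.mul_sum]
  congr 1
  · simp [gegenbauerCoeff]
  · refine Finset.sum_congr rfl fun j _ => ?_
    rw [mul_smul_comm]
    congr 1
    ring

/-- A harmonic polynomial is orthogonal to all multiples of `normSqForm`, so only the part `linForm
x ^ k` of `zonal k x` contributes, and it reproduces values. -/
lemma fischer_zonal_zonal (hσ : 3 ≤ Fintype.card σ) (k : ℕ) (x : σ → ℝ) {y : σ → ℝ}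
    (hy : ∑ i, y i ^ 2 = 1) :
    fischer (zonal k x) (zonal k y) = k.factorial * eval x (zonal k y) := by
  obtain ⟨r, hr⟩ := exists_zonal_eq k x
  rw [hr, map_add, LinearMap.add_apply, fischer_normSqForm_mul, polyLaplacian_zonal hσ k hy,
    map_zero, add_zero, fischer_linForm_pow x k (isHomogeneous_zonal k y)]

end Zonal

/-! ### Positive definiteness on spherical codes -/

section Code

variable {n : ℕ}

lemma sum_sq_eq_one {x : EuclideanSpace ℝ (Fin n)} (hx : ‖x‖ = 1) : ∑ i, x i ^ 2 = 1 := by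
  rw [← EuclideanSpace.real_norm_sq_eq, hx, one_pow]

lemma eval_zonal_eq_gegenbauer (k : ℕ) (x : EuclideanSpace ℝ (Fin n))
    {y : EuclideanSpace ℝ (Fin n)} (hy : ‖y‖ = 1) :
    MvPolynomial.eval (fun i => y i) (zonal k (fun i => x i)) = gegenbauer n k (inner ℝ x y) := by
  rw [eval_zonal k _ (sum_sq_eq_one hy), Fintype.card_fin]
  simp [PiLp.inner_apply, mul_comm]

variable {C : Finset (EuclideanSpace ℝ (Fin n))}

lemma IsSphericalCode.norm_eq (hC : IsSphericalCode C) {x : EuclideanSpace ℝ (Fin n)}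
    (hx : x ∈ C) : ‖x‖ = 1 := by
  simpa using hC hx

lemma IsSphericalCode.fischer_sum_zonal (hn : 3 ≤ n) (hC : IsSphericalCode C) (k : ℕ) :
    fischer (∑ x ∈ C, zonal k (fun i => x i)) (∑ x ∈ C, zonal k (fun i => x i))
      = k.factorial * ∑ x ∈ C, ∑ y ∈ C, gegenbauer n k (inner ℝ x y) := by
  rw [map_sum, Finset.mul_sum]
  refine Finset.sum_congr rfl fun x hx => ?_
  rw [map_sum, LinearMap.sum_apply, Finset.mul_sum]
  refine Finset.sum_congr rfl fun y hy => ?_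
  rw [fischer_zonal_zonal (by simpa using hn) k _ (sum_sq_eq_one (hC.norm_eq hx)),
    eval_zonal_eq_gegenbauer k x (hC.norm_eq hy)]

/-- Schoenberg: Gegenbauer polynomials are positive definite on the sphere. -/
lemma IsSphericalCode.sum_gegenbauer_nonneg (hn : 3 ≤ n) (hC : IsSphericalCode C) (k : ℕ) :
    0 ≤ ∑ x ∈ C, ∑ y ∈ C, gegenbauer n k (inner ℝ x y) := by
  have h := fischer_self_nonneg (∑ x ∈ C, zonal k (fun i => x i))
  rw [hC.fischer_sum_zonal hn] at h
  exact nonneg_of_mul_nonneg_right h (by positivity)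

/-- The sum of zonal harmonics has Fischer norm zero, so it is the zero polynomial and can be
evaluated at any unit `y`, in `C` or not. -/
lemma IsSphericalCode.sum_gegenbauer_eq_zero (hn : 3 ≤ n) (hC : IsSphericalCode C) {k : ℕ}
    (h : ∑ x ∈ C, ∑ y ∈ C, gegenbauer n k (inner ℝ x y) = 0) {y : EuclideanSpace ℝ (Fin n)}
    (hy : ‖y‖ = 1) : ∑ x ∈ C, gegenbauer n k (inner ℝ x y) = 0 := by
  have h0 := hC.fischer_sum_zonal hn k
  rw [h, mul_zero] at h0
  have h1 := congrArg (MvPolynomial.eval (fun i => y i)) (eq_zero_of_fischer_self_eq_zero h0)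
  rw [map_sum, map_zero] at h1
  rw [← h1]
  exact Finset.sum_congr rfl fun x _ => (eval_zonal_eq_gegenbauer k x hy).symm

end Code

lemma gegenbauer_neg (n k : ℕ) (t : ℝ) :
    gegenbauer n k (-t) = (-1) ^ k * gegenbauer n k t := by
  rw [gegenbauer, gegenbauer, Finset.mul_sum]
  refine Finset.sum_congr rfl fun j hj => ?_
  have hj' : 2 * j ≤ k := by have := Finset.mem_range.1 hj; omega
  have h : (-1 : ℝ) ^ k = (-1) ^ (k - 2 * j) := by
    conv_lhs => rw [← Nat.sub_add_cancel hj', pow_add, pow_mul]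
    simp
  rw [neg_pow, h]
  ring

/-! ### Isometry invariance of spherical means -/

section SphereSymmetry

variable {E : Type*} [NormedAddCommGroup E] [InnerProductSpace ℝ E] [FiniteDimensional ℝ E]
  [MeasurableSpace E] [BorelSpace E]

/-- The action of a linear isometry on the unit sphere. -/
noncomputable def sphereMap (e : E ≃ₗᵢ[ℝ] E) :
    Metric.sphere (0 : E) 1 ≃ᵐ Metric.sphere (0 : E) 1 where
  toFun z := ⟨e z, by simp⟩
  invFun z := ⟨e.symm z, by simp⟩
  left_inv z := by simp
  right_inv z := by simp
  measurable_toFun := by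
    exact Measurable.subtype_mk (e.continuous.measurable.comp measurable_subtype_coe)
  measurable_invFun := by
    exact Measurable.subtype_mk (e.symm.continuous.measurable.comp measurable_subtype_coe)

lemma measurePreserving_sphereMap (e : E ≃ₗᵢ[ℝ] E) :
    MeasurePreserving (sphereMap e) (volume : Measure E).toSphere
      (volume : Measure E).toSphere := by
  refine ⟨(sphereMap e).measurable, ?_⟩
  ext s hs
  -- `toSphere` measures a set through the volume of the cone over it, which isometries preserve.
  rw [Measure.map_apply (sphereMap e).measurable hs,
    Measure.toSphere_apply' _ ((sphereMap e).measurable hs), Measure.toSphere_apply' _ hs,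
    ← e.measurePreserving.measure_preimage_emb e.toHomeomorph.measurableEmbedding
      (Set.Ioo (0 : ℝ) 1 • (Subtype.val '' s))]
  congr 2
  ext v
  simp only [Set.mem_smul, Set.mem_preimage, Set.mem_image, Subtype.exists, exists_and_right,
    exists_eq_right]
  constructor
  · rintro ⟨r, hr, u, ⟨hu, hus⟩, rfl⟩
    exact ⟨r, hr, e u, ⟨by simpa using hu, hus⟩, by simp⟩
  · rintro ⟨r, hr, u, ⟨hu, hus⟩, h⟩
    refine ⟨r, hr, e.symm u, ⟨by simpa using hu, ?_⟩, ?_⟩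
    · convert hus
      exact e.apply_symm_apply u
    · rw [← map_smul, h, e.symm_apply_apply]

lemma sphere_average_comp (e : E ≃ₗᵢ[ℝ] E) (f : E → ℝ) :
    ⨍ z : Metric.sphere (0 : E) 1, f (e z) ∂(volume : Measure E).toSphere
      = ⨍ z : Metric.sphere (0 : E) 1, f z ∂(volume : Measure E).toSphere := by
  rw [average_eq, average_eq]
  congr 1
  exact (measurePreserving_sphereMap e).integral_comp' (fun z => f z)

lemma sphere_average_eq_zero_of_odd {f : E → ℝ} (hf : ∀ z, f (-z) = -f z) :
    ⨍ z : Metric.sphere (0 : E) 1, f z ∂(volume : Measure E).toSphere = 0 := by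
  have h := sphere_average_comp (LinearIsometryEquiv.neg ℝ (E := E)) f
  simp only [LinearIsometryEquiv.coe_neg, hf] at h
  rw [average_neg] at h
  linarith

lemma sphere_average_inner_pow_eq (k : ℕ) {x y : E} (h : ‖x‖ = ‖y‖) :
    ⨍ z : Metric.sphere (0 : E) 1, (inner ℝ x (z : E)) ^ k ∂(volume : Measure E).toSphere
      = ⨍ z : Metric.sphere (0 : E) 1, (inner ℝ y (z : E)) ^ k
          ∂(volume : Measure E).toSphere := by
  set e := Submodule.reflection (ℝ ∙ (x - y))ᗮ
  have he : e x = y := Submodule.reflection_sub h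
  rw [← sphere_average_comp e (fun z => (inner ℝ y z) ^ k), ← he]
  simp only [e.inner_map_map]

end SphereSymmetry


/-! ### Powers of linear forms span -/

section Functional

open MvPolynomial

variable {σ : Type*} [Fintype σ]

/-- A linear functional that vanishes on all `k`-th powers of linear forms vanishes on all
monomials of degree `k`. -/
lemma map_monomial_eq_zero_of_linForm_pow (L : MvPolynomial σ ℝ →ₗ[ℝ] ℝ) {k : ℕ}
    (hL : ∀ y : σ → ℝ, L (linForm y ^ k) = 0) {α : σ →₀ ℕ} (hα : α.degree = k) (a : ℝ) :
    L (monomial α a) = 0 := by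
  classical
  -- `G` is `y ↦ L (linForm y ^ k)` expanded by the multinomial theorem. It vanishes as a function,
  -- hence coefficientwise.
  set G : MvPolynomial σ ℝ := ∑ β ∈ Finset.piAntidiag Finset.univ k,
    monomial (Finsupp.equivFunOnFinite.symm β)
      (Nat.multinomial Finset.univ β * L (monomial (Finsupp.equivFunOnFinite.symm β) 1)) with hG
  have hG0 : G = 0 := by
    refine MvPolynomial.funext fun y => ?_
    rw [map_zero, ← hL y, linForm, Finset.sum_pow_eq_sum_piAntidiag, hG, map_sum, map_sum]
    refine Finset.sum_congr rfl fun β _ => ?_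
    have h : (Nat.multinomial Finset.univ β : MvPolynomial σ ℝ) * ∏ i, (C (y i) * X i) ^ β i
        = ((Nat.multinomial Finset.univ β : ℝ) * ∏ i, y i ^ β i) •
          monomial (Finsupp.equivFunOnFinite.symm β) 1 := by
      rw [smul_eq_C_mul, monomial_eq]
      simp [mul_pow, Finset.prod_mul_distrib, Finsupp.prod_fintype, mul_assoc]
    rw [h, map_smul, eval_monomial, Finsupp.prod_fintype _ _ (by simp), smul_eq_mul]
    simp only [Finsupp.equivFunOnFinite_symm_apply_apply]
    ring
  have hc := congrArg (coeff α) hG0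
  rw [hG, coeff_sum, coeff_zero, Finset.sum_eq_single (α : σ → ℕ)] at hc
  · rw [Finsupp.equivFunOnFinite_symm_coe, coeff_monomial, if_pos rfl] at hc
    have hm : (Nat.multinomial Finset.univ (α : σ → ℕ) : ℝ) ≠ 0 := by
      exact_mod_cast (Nat.multinomial_pos _ _).ne'
    have h1 := (mul_eq_zero.1 hc).resolve_left hm
    rw [← mul_one a, ← smul_eq_mul, ← smul_monomial, map_smul, h1, smul_zero]
  · intro β _ hβ
    rw [coeff_monomial, if_neg]
    rintro rfl
    exact hβ (by simp)
  · intro h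
    exact absurd (by simp [Finset.mem_piAntidiag, ← hα, Finsupp.degree_eq_sum]) h

end Functional

/-! ### Designs and Gegenbauer sums -/

section Design

variable {n : ℕ} {C : Finset (EuclideanSpace ℝ (Fin n))}

lemma integrable_eval_toSphere (p : MvPolynomial (Fin n) ℝ) :
    Integrable (fun z : Metric.sphere (0 : EuclideanSpace ℝ (Fin n)) 1 =>
      MvPolynomial.eval (fun i => (z : EuclideanSpace ℝ (Fin n)) i) p)
      (volume : Measure (EuclideanSpace ℝ (Fin n))).toSphere := by
  refine Continuous.integrable_of_hasCompactSupport ?_ (HasCompactSupport.of_compactSpace _)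
  exact p.continuous_eval.comp (by fun_prop)

/-- The mean over the sphere minus the mean over `C`, as a linear functional on polynomials. -/
noncomputable def designDefect (C : Finset (EuclideanSpace ℝ (Fin n))) :
    MvPolynomial (Fin n) ℝ →ₗ[ℝ] ℝ where
  toFun p := ⨍ x : Metric.sphere (0 : EuclideanSpace ℝ (Fin n)) 1,
      MvPolynomial.eval (fun i => (x : EuclideanSpace ℝ (Fin n)) i) p
        ∂((volume : Measure (EuclideanSpace ℝ (Fin n))).toSphere)
    - (1 / (C.card : ℝ)) * ∑ x ∈ C, MvPolynomial.eval (fun i => x i) p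
  map_add' p q := by
    simp only [map_add, Finset.sum_add_distrib, average_eq]
    rw [integral_add (integrable_eval_toSphere p) (integrable_eval_toSphere q)]
    simp only [smul_eq_mul]
    ring
  map_smul' r p := by
    simp only [MvPolynomial.smul_eval, average_eq, integral_const_mul, ← Finset.mul_sum,
      smul_eq_mul, RingHom.id_apply]
    ring

lemma isSphericalDesign_iff {τ : ℕ} : IsSphericalDesign τ C ↔ IsSphericalCode C ∧
    ∀ p : MvPolynomial (Fin n) ℝ, p.totalDegree ≤ τ → designDefect C p = 0 := by
  simp only [IsSphericalDesign, designDefect, LinearMap.coe_mk, AddHom.coe_mk, sub_eq_zero]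

/-- Spherical designs are detected by powers of linear forms with unit coefficient vector. -/
lemma isSphericalDesign_of_linForm_pow {τ : ℕ} (hn : n ≠ 0) (hC : IsSphericalCode C)
    (h : ∀ k ≤ τ, ∀ y : EuclideanSpace ℝ (Fin n), ‖y‖ = 1 →
      designDefect C (linForm (fun i => y i) ^ k) = 0) : IsSphericalDesign τ C := by
  refine isSphericalDesign_iff.2 ⟨hC, fun p hp => ?_⟩
  rw [p.as_sum, map_sum]
  refine Finset.sum_eq_zero fun α hα => ?_
  have hαk : α.degree ≤ τ := (MvPolynomial.le_totalDegree hα).trans hp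
  refine map_monomial_eq_zero_of_linForm_pow _ (fun y => ?_) rfl _
  have : Nonempty (Fin n) := ⟨⟨0, Nat.pos_of_ne_zero hn⟩⟩
  obtain ⟨u, hu, hyu⟩ : ∃ u : EuclideanSpace ℝ (Fin n), ‖u‖ = 1 ∧
      WithLp.toLp 2 y = ‖WithLp.toLp 2 y‖ • u := by
    by_cases hy : WithLp.toLp 2 y = 0
    · obtain ⟨u, hu⟩ := exists_norm_eq (EuclideanSpace ℝ (Fin n)) zero_le_one
      exact ⟨u, hu, by simp [hy]⟩
    · exact ⟨‖WithLp.toLp 2 y‖⁻¹ • WithLp.toLp 2 y, by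
        rw [norm_smul, norm_inv, norm_norm, inv_mul_cancel₀ (norm_ne_zero_iff.2 hy)], by
        rw [smul_inv_smul₀ (norm_ne_zero_iff.2 hy)]⟩
  have hlin : linForm y = ‖WithLp.toLp 2 y‖ • linForm (fun i => u i) := by
    rw [linForm, linForm, Finset.smul_sum]
    refine Finset.sum_congr rfl fun i _ => ?_
    have hi : y i = ‖WithLp.toLp 2 y‖ * u i := congrArg (fun v => v i) hyu
    rw [MvPolynomial.smul_eq_C_mul, ← mul_assoc, ← map_mul, ← hi]
  rw [hlin, smul_pow, map_smul, h _ hαk u hu, smul_zero]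

lemma eval_linForm_pow (k : ℕ) (x y : EuclideanSpace ℝ (Fin n)) :
    MvPolynomial.eval (fun i => x i) (linForm (fun i => y i) ^ k) = (inner ℝ y x) ^ k := by
  rw [map_pow, eval_linForm]
  simp [PiLp.inner_apply, mul_comm]

/-- If the `k`-th power sums of a code do not depend on the direction, then they agree with the
moments of the sphere. -/
lemma designDefect_linForm_pow_eq_zero (hC : IsSphericalCode C) (hne : C.Nonempty) {k : ℕ} {c : ℝ}
    (h : ∀ y : EuclideanSpace ℝ (Fin n), ‖y‖ = 1 → ∑ x ∈ C, (inner ℝ x y) ^ k = c)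
    {y : EuclideanSpace ℝ (Fin n)} (hy : ‖y‖ = 1) :
    designDefect C (linForm (fun i => y i) ^ k) = 0 := by
  have hN : (C.card : ℝ) ≠ 0 := by simpa using hne.ne_empty
  have hnt : Nontrivial (EuclideanSpace ℝ (Fin n)) := ⟨y, 0, by rintro rfl; simp at hy⟩
  have : NeZero (volume : Measure (EuclideanSpace ℝ (Fin n))).toSphere :=
    ⟨Measure.toSphere_ne_zero _⟩
  simp only [designDefect, LinearMap.coe_mk, AddHom.coe_mk, eval_linForm_pow]
  -- Averaging the constant power sum over all directions; by symmetry each `x` then contributes the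
  -- same moment.
  have h1 : ∑ x ∈ C, ⨍ z : Metric.sphere (0 : EuclideanSpace ℝ (Fin n)) 1,
      (inner ℝ x (z : EuclideanSpace ℝ (Fin n))) ^ k
        ∂(volume : Measure (EuclideanSpace ℝ (Fin n))).toSphere = c := by
    simp only [average_eq, ← Finset.smul_sum]
    rw [← integral_finsetSum]
    · rw [← average_eq, ← average_const (volume : Measure (EuclideanSpace ℝ (Fin n))).toSphere c]
      congr 1
      ext z
      exact h z (by simp)
    · intro x _
      simpa only [eval_linForm_pow] using integrable_eval_toSphere (linForm (fun i => x i) ^ k)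
  have h2 : ∀ x ∈ C, ⨍ z : Metric.sphere (0 : EuclideanSpace ℝ (Fin n)) 1,
      (inner ℝ x (z : EuclideanSpace ℝ (Fin n))) ^ k
        ∂(volume : Measure (EuclideanSpace ℝ (Fin n))).toSphere
      = ⨍ z : Metric.sphere (0 : EuclideanSpace ℝ (Fin n)) 1,
      (inner ℝ y (z : EuclideanSpace ℝ (Fin n))) ^ k
        ∂(volume : Measure (EuclideanSpace ℝ (Fin n))).toSphere := fun x hx =>
    sphere_average_inner_pow_eq k ((hC.norm_eq hx).trans hy.symm)
  rw [Finset.sum_congr rfl h2, Finset.sum_const, nsmul_eq_mul] at h1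
  have h3 := h y hy
  simp only [real_inner_comm y] at h3
  rw [h3, ← h1]
  field_simp
  ring

/-- If the Gegenbauer sums of degrees `1, …, τ` vanish, then the power sums up to degree `τ` do not
depend on the direction. -/
lemma exists_sum_inner_pow_eq {τ : ℕ}
    (h : ∀ k, 1 ≤ k → k ≤ τ → ∀ y : EuclideanSpace ℝ (Fin n), ‖y‖ = 1 →
      ∑ x ∈ C, gegenbauer n k (inner ℝ x y) = 0) (k : ℕ) (hk : k ≤ τ) :
    ∃ c : ℝ, ∀ y : EuclideanSpace ℝ (Fin n), ‖y‖ = 1 → ∑ x ∈ C, (inner ℝ x y) ^ k = c := by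
  induction k using Nat.strong_induction_on with
  | _ k ih =>
    rcases Nat.eq_zero_or_pos k with rfl | hk0
    · exact ⟨C.card, fun y _ => by simp⟩
    · have hex : ∀ j, ∃ c : ℝ, j < k / 2 → ∀ y : EuclideanSpace ℝ (Fin n), ‖y‖ = 1 →
          ∑ x ∈ C, (inner ℝ x y) ^ (k - 2 * (j + 1)) = c := fun j => by
        by_cases hj : j < k / 2
        · obtain ⟨c, hc⟩ := ih (k - 2 * (j + 1)) (by omega) (by omega)
          exact ⟨c, fun _ => hc⟩
        · exact ⟨0, fun h => absurd h hj⟩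
      choose c hc using hex
      -- The Gegenbauer polynomial is monic, so its vanishing sum expresses the `k`-th power sum
      -- through lower ones.
      refine ⟨-∑ j ∈ Finset.range (k / 2), gegenbauerCoeff n k (j + 1) * c j, fun y hy => ?_⟩
      have h0 := h k hk0 hk y hy
      simp only [gegenbauer, Finset.sum_range_succ'] at h0
      rw [Finset.sum_add_distrib, Finset.sum_comm, Finset.sum_congr rfl
        fun j hj => (by rw [← Finset.mul_sum, hc j (Finset.mem_range.1 hj) y hy] :
          _ = gegenbauerCoeff n k (j + 1) * c j)] at h0
      simp only [gegenbauerCoeff, one_mul, mul_zero, Nat.sub_zero] at h0 ⊢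
      linarith

lemma isSphericalDesign_of_sum_gegenbauer (hn : 3 ≤ n) (hC : IsSphericalCode C) (hne : C.Nonempty)
    {τ : ℕ} (h : ∀ k, 1 ≤ k → k ≤ τ →
      ∑ x ∈ C, ∑ y ∈ C, gegenbauer n k (inner ℝ x y) = 0) : IsSphericalDesign τ C := by
  refine isSphericalDesign_of_linForm_pow (by omega) hC fun k hk y hy => ?_
  obtain ⟨c, hc⟩ := exists_sum_inner_pow_eq
    (fun k hk hk' y hy => hC.sum_gegenbauer_eq_zero hn (h k hk hk') hy) k hk
  exact designDefect_linForm_pow_eq_zero hC hne hc hy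

/-- The design property applies to `zonal k x`, whose spherical mean is zero by oddness. -/
lemma IsSphericalDesign.sum_gegenbauer_eq_zero_of_odd {τ k : ℕ} (hC : IsSphericalDesign τ C)
    (hk : Odd k) (hkτ : k ≤ τ) : ∑ x ∈ C, ∑ y ∈ C, gegenbauer n k (inner ℝ x y) = 0 := by
  refine Finset.sum_eq_zero fun x hx => ?_
  have h := hC.2 (zonal k (fun i => x i)) ((isHomogeneous_zonal k _).totalDegree_le.trans hkτ)
  have hz : ∀ z : Metric.sphere (0 : EuclideanSpace ℝ (Fin n)) 1,
      MvPolynomial.eval (fun i => (z : EuclideanSpace ℝ (Fin n)) i) (zonal k (fun i => x i))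
        = gegenbauer n k (inner ℝ x (z : EuclideanSpace ℝ (Fin n))) := fun z =>
    eval_zonal_eq_gegenbauer k x (by simp)
  simp only [hz] at h
  rw [sphere_average_eq_zero_of_odd
      (f := fun z : EuclideanSpace ℝ (Fin n) => gegenbauer n k (inner ℝ x z)) (fun z => by
        rw [inner_neg_right, gegenbauer_neg, hk.neg_one_pow, neg_one_mul]),
    Finset.sum_congr rfl fun y hy => eval_zonal_eq_gegenbauer k x (hC.1.norm_eq hy)] at h
  have hN : (1 / (C.card : ℝ)) ≠ 0 := by
    have := Finset.card_ne_zero_of_mem hx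
    positivity
  exact (mul_eq_zero.1 h.symm).resolve_left hN

lemma IsAntipodalCode.neg_mem (hC : IsAntipodalCode C) {x : EuclideanSpace ℝ (Fin n)}
    (hx : x ∈ C) : -x ∈ C := by
  have h : x ∈ (C : Set (EuclideanSpace ℝ (Fin n))) := hx
  rw [hC] at h
  exact h

lemma IsAntipodalCode.sum_gegenbauer_eq_zero_of_odd {k : ℕ} (hC : IsAntipodalCode C)
    (hk : Odd k) : ∑ x ∈ C, ∑ y ∈ C, gegenbauer n k (inner ℝ x y) = 0 := by
  refine Finset.sum_eq_zero fun x _ => ?_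
  have h : ∑ y ∈ C, gegenbauer n k (inner ℝ x y) = ∑ y ∈ C, gegenbauer n k (inner ℝ x (-y)) :=
    Finset.sum_nbij' (fun y => -y) (fun y => -y) (fun _ hy => hC.neg_mem hy)
      (fun _ hy => hC.neg_mem hy) (by simp) (by simp) (by simp)
  simp only [inner_neg_right, gegenbauer_neg, hk.neg_one_pow, neg_one_mul,
    Finset.sum_neg_distrib] at h
  linarith

end Design

/-! ### Dimension 48 and the auxiliary polynomial -/

lemma gegenbauer_48_0 (t : ℝ) : gegenbauer 48 0 t
    = 1 := by
  norm_num [gegenbauer, gegenbauerCoeff, Finset.sum_range_succ]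

lemma gegenbauer_48_1 (t : ℝ) : gegenbauer 48 1 t
    = t := by
  norm_num [gegenbauer, gegenbauerCoeff, Finset.sum_range_succ]

lemma gegenbauer_48_2 (t : ℝ) : gegenbauer 48 2 t
    = t ^ 2 - 1 / 48 := by
  norm_num [gegenbauer, gegenbauerCoeff, Finset.sum_range_succ]
  ring

lemma gegenbauer_48_3 (t : ℝ) : gegenbauer 48 3 t
    = t ^ 3 - 3 / 50 * t := by
  norm_num [gegenbauer, gegenbauerCoeff, Finset.sum_range_succ]
  ring

lemma gegenbauer_48_4 (t : ℝ) : gegenbauer 48 4 t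
    = t ^ 4 - 3 / 26 * t ^ 2 + 3 / 2600 := by
  norm_num [gegenbauer, gegenbauerCoeff, Finset.sum_range_succ]
  ring

lemma gegenbauer_48_5 (t : ℝ) : gegenbauer 48 5 t
    = t ^ 5 - 5 / 27 * t ^ 3 + 5 / 936 * t := by
  norm_num [gegenbauer, gegenbauerCoeff, Finset.sum_range_succ]
  ring

lemma gegenbauer_48_6 (t : ℝ) : gegenbauer 48 6 t
    = t ^ 6 - 15 / 56 * t ^ 4 + 5 / 336 * t ^ 2 - 5 / 52416 := by
  norm_num [gegenbauer, gegenbauerCoeff, Finset.sum_range_succ]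
  ring

lemma gegenbauer_48_7 (t : ℝ) : gegenbauer 48 7 t
    = t ^ 7 - 21 / 58 * t ^ 5 + 15 / 464 * t ^ 3 - 5 / 8352 * t := by
  norm_num [gegenbauer, gegenbauerCoeff, Finset.sum_range_succ]
  ring

lemma gegenbauer_48_8 (t : ℝ) : gegenbauer 48 8 t
    = t ^ 8 - 7 / 15 * t ^ 6 + 7 / 116 * t ^ 4 - 1 / 464 * t ^ 2 + 1 / 100224 := by
  norm_num [gegenbauer, gegenbauerCoeff, Finset.sum_range_succ]
  ring

lemma gegenbauer_48_9 (t : ℝ) : gegenbauer 48 9 t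
    = t ^ 9 - 18 / 31 * t ^ 7 + 63 / 620 * t ^ 5 - 21 / 3596 * t ^ 3 + 9 / 115072 * t := by
  norm_num [gegenbauer, gegenbauerCoeff, Finset.sum_range_succ]
  ring

lemma gegenbauer_48_10 (t : ℝ) : gegenbauer 48 10 t
    = t ^ 10 - 45 / 64 * t ^ 8 + 315 / 1984 * t ^ 6 - 105 / 7936 * t ^ 4 + 315 / 920576 * t ^ 2 - 9 / 7364608 := by
  norm_num [gegenbauer, gegenbauerCoeff, Finset.sum_range_succ]
  ring

lemma gegenbauer_48_11 (t : ℝ) : gegenbauer 48 11 t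
    = t ^ 11 - 5 / 6 * t ^ 9 + 15 / 64 * t ^ 7 - 105 / 3968 * t ^ 5 + 35 / 31744 * t ^ 3 - 21 / 1841152 * t := by
  norm_num [gegenbauer, gegenbauerCoeff, Finset.sum_range_succ]
  ring

/-- The polynomial of the linear programming bound. -/
noncomputable def lpPoly (t : ℝ) : ℝ :=
  (t + 1) ^ 2 * (t + 1 / 2) ^ 2 * ((t + 1 / 3) * (t + 1 / 6)) * t ^ 2
    * ((t - 1 / 6) * (t - 1 / 3)) * (t - 1 / 2)

/-- What matters is the signs: only the degree 3 coefficient is negative. -/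
lemma lpPoly_eq (t : ℝ) : lpPoly t
    = 1 / 13478400 * gegenbauer 48 0 t + 3961 / 1758931200 * gegenbauer 48 1 t
      + 1 / 183222 * gegenbauer 48 2 t - 2531 / 16236288 * gegenbauer 48 3 t + 53 / 601344 * gegenbauer 48 4 t
      + 163637 / 11651040 * gegenbauer 48 5 t + 41419 / 401760 * gegenbauer 48 6 t + 71515 / 160704 * gegenbauer 48 7 t
      + 1481 / 1152 * gegenbauer 48 8 t + 22 / 9 * gegenbauer 48 9 t + 5 / 2 * gegenbauer 48 10 t
      + 1 * gegenbauer 48 11 t := by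
  rw [lpPoly, gegenbauer_48_0, gegenbauer_48_1, gegenbauer_48_2, gegenbauer_48_3, gegenbauer_48_4,
    gegenbauer_48_5, gegenbauer_48_6, gegenbauer_48_7, gegenbauer_48_8, gegenbauer_48_9,
    gegenbauer_48_10, gegenbauer_48_11]
  ring

/-- The two quadratic brackets are negative exactly on the removed intervals; the other factors are
squares and `t - 1/2`. -/
lemma lpPoly_nonpos {t : ℝ} (ht : t ∈ allowedInnerProducts) : lpPoly t ≤ 0 := by
  obtain ⟨⟨h1, h2⟩, h3⟩ := ht
  simp only [Set.mem_union, Set.mem_Ioo, not_or, not_and, not_lt] at h3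
  have ha : 0 ≤ (t + 1 / 3) * (t + 1 / 6) := by
    by_cases h : -1 / 3 < t
    · have := h3.1 h
      exact mul_nonneg (by linarith) (by linarith)
    · exact mul_nonneg_of_nonpos_of_nonpos (by linarith) (by linarith)
  have hb : 0 ≤ (t - 1 / 6) * (t - 1 / 3) := by
    by_cases h : 1 / 6 < t
    · have := h3.2 h
      exact mul_nonneg (by linarith) (by linarith)
    · exact mul_nonneg_of_nonpos_of_nonpos (by linarith) (by linarith)
  exact mul_nonpos_of_nonneg_of_nonpos (by positivity) (by linarith)

/-- The inner products that occur in an optimal code. -/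
def optimalInnerProducts : Set ℝ := {-1, -1 / 2, -1 / 3, -1 / 6, 0, 1 / 6, 1 / 3, 1 / 2}

lemma mem_optimalInnerProducts_of_lpPoly_eq_zero {t : ℝ} (ht : lpPoly t = 0) :
    t ∈ optimalInnerProducts := by
  simp only [lpPoly, mul_eq_zero, pow_eq_zero_iff, ne_eq, OfNat.ofNat_ne_zero,
    not_false_eq_true] at ht
  simp only [optimalInnerProducts, Set.mem_insert_iff, Set.mem_singleton_iff]
  rcases ht with ((((h | h) | (h | h)) | h) | (h | h)) | h
  · left; linarith
  · right; left; linarith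
  · right; right; left; linarith
  · right; right; right; left; linarith
  · right; right; right; right; left; linarith
  · right; right; right; right; right; left; linarith
  · right; right; right; right; right; right; left; linarith
  · right; right; right; right; right; right; right; linarith

/-! ### The bound and its equality case -/

section Bound

variable {C : Finset (EuclideanSpace ℝ (Fin 48))}

/-- The linear programming bound together with the conditions for equality. -/
lemma card_le_and_of_card_eq (hC : IsSphericalCode C)
    (hI : innerProductSet C ⊆ allowedInnerProducts)
    (h3 : ∑ x ∈ C, ∑ y ∈ C, gegenbauer 48 3 (inner ℝ x y) = 0) :
    C.card ≤ 52416000 ∧ (C.card = 52416000 →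
      (∀ k, 1 ≤ k → k ≤ 11 → ∑ x ∈ C, ∑ y ∈ C, gegenbauer 48 k (inner ℝ x y) = 0) ∧
      innerProductSet C ⊆ optimalInnerProducts) := by
  classical
  set S : ℕ → ℝ := fun k => ∑ x ∈ C, ∑ y ∈ C, gegenbauer 48 k (inner ℝ x y) with hS
  have hS0 : S 0 = (C.card : ℝ) ^ 2 := by
    simp [hS, gegenbauer_48_0, pow_two]
  have hS3 : S 3 = 0 := h3
  have hpos : ∀ k, 0 ≤ S k := fun k => hC.sum_gegenbauer_nonneg (by norm_num) k
  have hsum : ∑ x ∈ C, ∑ y ∈ C, lpPoly (inner ℝ x y)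
      = 1 / 13478400 * S 0 + 3961 / 1758931200 * S 1 + 1 / 183222 * S 2
        - 2531 / 16236288 * S 3 + 53 / 601344 * S 4 + 163637 / 11651040 * S 5
        + 41419 / 401760 * S 6 + 71515 / 160704 * S 7 + 1481 / 1152 * S 8 + 22 / 9 * S 9
        + 5 / 2 * S 10 + 1 * S 11 := by
    simp only [hS, lpPoly_eq, Finset.sum_add_distrib, Finset.sum_sub_distrib, ← Finset.mul_sum]
  have hdiag : ∑ x ∈ C, ∑ y ∈ C, lpPoly (inner ℝ x y)
      = 35 / 9 * C.card + ∑ x ∈ C, ∑ y ∈ C.erase x, lpPoly (inner ℝ x y) := by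
    have h : ∀ x ∈ C, ∑ y ∈ C, lpPoly (inner ℝ x y)
        = 35 / 9 + ∑ y ∈ C.erase x, lpPoly (inner ℝ x y) := fun x hx => by
      rw [← Finset.add_sum_erase _ _ hx, real_inner_self_eq_norm_sq, hC.norm_eq hx]
      norm_num [lpPoly]
    rw [Finset.sum_congr rfl h, Finset.sum_add_distrib, Finset.sum_const, nsmul_eq_mul, mul_comm]
  have hoff : ∀ x ∈ C, ∀ y ∈ C.erase x, lpPoly (inner ℝ x y) ≤ 0 := fun x hx y hy =>
    lpPoly_nonpos (hI ⟨x, hx, y, Finset.mem_of_mem_erase hy, (Finset.ne_of_mem_erase hy).symm, rfl⟩)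
  have hoff' : ∀ x ∈ C, ∑ y ∈ C.erase x, lpPoly (inner ℝ x y) ≤ 0 := fun x hx =>
    Finset.sum_nonpos (hoff x hx)
  have hD := Finset.sum_nonpos hoff'
  have p1 := hpos 1
  have p2 := hpos 2
  have p4 := hpos 4
  have p5 := hpos 5
  have p6 := hpos 6
  have p7 := hpos 7
  have p8 := hpos 8
  have p9 := hpos 9
  have p10 := hpos 10
  have p11 := hpos 11
  rw [hS0, hS3] at hsum
  refine ⟨?_, fun hN => ⟨fun k hk1 hk2 => ?_, ?_⟩⟩
  -- Here `52416000 = 13478400 * 35 / 9`, with `35 / 9 = lpPoly 1`.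
  · have h : (C.card : ℝ) * C.card ≤ 52416000 * C.card := by linarith
    rcases Nat.eq_zero_or_pos C.card with h0 | h0
    · omega
    · exact_mod_cast le_of_mul_le_mul_right h (by exact_mod_cast h0)
  · change S k = 0
    rw [hN] at hsum hdiag
    push_cast at hsum hdiag
    -- At equality the constant term already equals the diagonal, so nonnegative terms sum to
    -- something nonpositive; `k = 3` is `hS3`.
    interval_cases k <;> linarith
  · rw [hN] at hsum hdiag
    push_cast at hsum hdiag
    have hD0 : ∑ x ∈ C, ∑ y ∈ C.erase x, lpPoly (inner ℝ x y) = 0 := by linarith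
    rintro t ⟨x, hx, y, hy, hxy, rfl⟩
    have h1 := (Finset.sum_eq_zero_iff_of_nonpos hoff').1 hD0 x hx
    have h2 := (Finset.sum_eq_zero_iff_of_nonpos (hoff x hx)).1 h1 y
      (Finset.mem_erase.2 ⟨hxy.symm, hy⟩)
    exact mem_optimalInnerProducts_of_lpPoly_eq_zero h2

lemma IsSphericalCode.distanceCount_one {n : ℕ} {C : Finset (EuclideanSpace ℝ (Fin n))}
    (hC : IsSphericalCode C) {x : EuclideanSpace ℝ (Fin n)} (hx : x ∈ C) :
    distanceCount C x 1 = 1 := by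
  rw [distanceCount, Finset.card_eq_one]
  refine ⟨x, Finset.ext fun y => ?_⟩
  rw [Finset.mem_filter, Finset.mem_singleton]
  constructor
  · rintro ⟨hy, h⟩
    exact ((inner_eq_one_iff_of_norm_eq_one (hC.norm_eq hx) (hC.norm_eq hy)).1 h).symm
  · rintro rfl
    exact ⟨hx, by rw [real_inner_self_eq_norm_sq, hC.norm_eq hx, one_pow]⟩

/-- Sums over an optimal code in terms of its distance distribution. -/
lemma sum_eq_sum_distanceCount (hC : IsSphericalCode C)
    (hI : innerProductSet C ⊆ optimalInnerProducts) {x : EuclideanSpace ℝ (Fin 48)} (hx : x ∈ C)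
    (g : ℝ → ℝ) :
    ∑ y ∈ C, g (inner ℝ x y) = g 1 + distanceCount C x (-1) * g (-1)
      + distanceCount C x (-1 / 2) * g (-1 / 2) + distanceCount C x (-1 / 3) * g (-1 / 3)
      + distanceCount C x (-1 / 6) * g (-1 / 6) + distanceCount C x 0 * g 0
      + distanceCount C x (1 / 6) * g (1 / 6) + distanceCount C x (1 / 3) * g (1 / 3)
      + distanceCount C x (1 / 2) * g (1 / 2) := by
  classical
  set T : Finset ℝ := {1, -1, -1 / 2, -1 / 3, -1 / 6, 0, 1 / 6, 1 / 3, 1 / 2} with hT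
  have hmaps : ∀ y ∈ C, inner ℝ x y ∈ T := fun y hy => by
    by_cases hxy : x = y
    · rw [← hxy, real_inner_self_eq_norm_sq, hC.norm_eq hx]
      simp [hT]
    · have h := hI ⟨x, hx, y, hy, hxy, rfl⟩
      simp only [optimalInnerProducts, Set.mem_insert_iff, Set.mem_singleton_iff] at h
      simp only [hT, Finset.mem_insert, Finset.mem_singleton]
      exact Or.inr h
  rw [← Finset.sum_fiberwise_of_maps_to hmaps]
  have hfib : ∀ t ∈ T, ∑ y ∈ C with inner ℝ x y = t, g (inner ℝ x y)
      = distanceCount C x t * g t := fun t _ => by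
    rw [Finset.sum_congr rfl fun y hy => by rw [(Finset.mem_filter.1 hy).2], Finset.sum_const,
      nsmul_eq_mul, distanceCount]
  rw [Finset.sum_congr rfl hfib, hT]
  repeat rw [Finset.sum_insert (by norm_num)]
  rw [Finset.sum_singleton, hC.distanceCount_one hx]
  push_cast
  ring

/-- The cardinality and Gegenbauer degrees 1 to 7 give eight equations in eight unknowns, a
Vandermonde system in another basis. -/
lemma distanceCount_of_optimal (hC : IsSphericalCode C)
    (hI : innerProductSet C ⊆ optimalInnerProducts) (hN : C.card = 52416000)
    (hS : ∀ k, 1 ≤ k → k ≤ 11 → ∑ x ∈ C, ∑ y ∈ C, gegenbauer 48 k (inner ℝ x y) = 0)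
    {x : EuclideanSpace ℝ (Fin 48)} (hx : x ∈ C) :
    distanceCount C x (-1) = 1 ∧
    distanceCount C x (1 / 2) = 36848 ∧
    distanceCount C x (-1 / 2) = 36848 ∧
    distanceCount C x (1 / 3) = 1678887 ∧
    distanceCount C x (-1 / 3) = 1678887 ∧
    distanceCount C x (1 / 6) = 12608784 ∧
    distanceCount C x (-1 / 6) = 12608784 ∧
    distanceCount C x 0 = 23766960 := by
  have hz : ∀ k, 1 ≤ k → k ≤ 11 → ∑ y ∈ C, gegenbauer 48 k (inner ℝ x y) = 0 :=
    fun k h1 h2 => by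
      have h := hC.sum_gegenbauer_eq_zero (by norm_num) (hS k h1 h2) (hC.norm_eq hx)
      simpa only [real_inner_comm] using h
  have e0 := sum_eq_sum_distanceCount hC hI hx (fun _ => 1)
  simp only [Finset.sum_const, hN, nsmul_eq_mul, mul_one] at e0
  push_cast at e0
  have e1 := (sum_eq_sum_distanceCount hC hI hx (gegenbauer 48 1)).symm.trans
    (hz 1 (by norm_num) (by norm_num))
  have e2 := (sum_eq_sum_distanceCount hC hI hx (gegenbauer 48 2)).symm.trans
    (hz 2 (by norm_num) (by norm_num))
  have e3 := (sum_eq_sum_distanceCount hC hI hx (gegenbauer 48 3)).symm.trans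
    (hz 3 (by norm_num) (by norm_num))
  have e4 := (sum_eq_sum_distanceCount hC hI hx (gegenbauer 48 4)).symm.trans
    (hz 4 (by norm_num) (by norm_num))
  have e5 := (sum_eq_sum_distanceCount hC hI hx (gegenbauer 48 5)).symm.trans
    (hz 5 (by norm_num) (by norm_num))
  have e6 := (sum_eq_sum_distanceCount hC hI hx (gegenbauer 48 6)).symm.trans
    (hz 6 (by norm_num) (by norm_num))
  have e7 := (sum_eq_sum_distanceCount hC hI hx (gegenbauer 48 7)).symm.trans
    (hz 7 (by norm_num) (by norm_num))
  simp only [gegenbauer_48_1] at e1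
  simp only [gegenbauer_48_2] at e2
  simp only [gegenbauer_48_3] at e3
  simp only [gegenbauer_48_4] at e4
  simp only [gegenbauer_48_5] at e5
  simp only [gegenbauer_48_6] at e6
  simp only [gegenbauer_48_7] at e7
  -- The multipliers are Gegenbauer coefficients of the Lagrange polynomials at the eight nodes;
  -- `e0` has its sides swapped, hence the sign.
  have h0 : (distanceCount C x (-1) : ℝ) = 1 := by
    linear_combination -(1 / 546000) * e1 - (1 / 1260) * e3 + (6 / 145) * e5 - (54 / 35) * e7
  have h1 : (distanceCount C x (1 / 2) : ℝ) = 36848 := by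
    linear_combination -(11 / 15600) * e0 + (331 / 19500) * e1 + (1 / 5) * e2 + (137 / 90) *
      e3 + (117 / 14) * e4 + (906 / 29) * e5 + (324 / 5) * e6 + (216 / 5) * e7
  have h2 : (distanceCount C x (-1 / 2) : ℝ) = 36848 := by
    linear_combination -(11 / 15600) * e0 - (109 / 6500) * e1 + (1 / 5) * e2 - (43 / 30) * e3
      + (117 / 14) * e4 - (5202 / 145) * e5 + (324 / 5) * e6 + (648 / 5) * e7
  have h3 : (distanceCount C x (1 / 3) : ℝ) = 1678887 := by
    linear_combination -(333 / 10400) * e0 + (13311 / 26000) * e1 + (459 / 130) * e2 + (237 /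
      20) * e3 + (27 / 7) * e4 - (17658 / 145) * e5 - (1944 / 5) * e6 - (1458 / 5) * e7
  have h4 : (distanceCount C x (-1 / 3) : ℝ) = 1678887 := by
    linear_combination -(333 / 10400) * e0 - (513 / 1000) * e1 + (459 / 130) * e2 - (123 / 10)
      * e3 + (27 / 7) * e4 + (4212 / 29) * e5 - (1944 / 5) * e6 - (2916 / 5) * e7
  have h5 : (distanceCount C x (1 / 6) : ℝ) = 12608784 := by
    linear_combination -(1251 / 5200) * e0 + (17523 / 9100) * e1 + (27 / 13) * e2 - (393 / 14)
      * e3 - (1269 / 14) * e4 + (4050 / 29) * e5 + (972) * e6 + (5832 / 7) * e7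
  have h6 : (distanceCount C x (-1 / 6) : ℝ) = 12608784 := by
    linear_combination -(1251 / 5200) * e0 - (12501 / 6500) * e1 + (27 / 13) * e2 + (291 / 10)
      * e3 - (1269 / 14) * e4 - (28026 / 145) * e5 + (972) * e6 + (5832 / 5) * e7
  have h7 : (distanceCount C x (0) : ℝ) = 23766960 := by
    linear_combination -(7073 / 15600) * e0 - (1 / 650) * e1 - (151 / 13) * e2 - (2 / 3) * e3
      + (1098 / 7) * e4 + (1008 / 29) * e5 - (1296) * e6 - (1296) * e7
  exact_mod_cast (⟨h0, h1, h2, h3, h4, h5, h6, h7⟩ : _ ∧ _ ∧ _ ∧ _ ∧ _ ∧ _ ∧ _ ∧ _)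

end Bound

theorem mainTheorem1 (C : Finset (EuclideanSpace ℝ (Fin 48)))
    (hC : IsSphericalCode C)
    (hI : innerProductSet C ⊆ allowedInnerProducts)
    (h : IsAntipodalCode C ∨ IsSphericalDesign 3 C) :
    C.card ≤ 52416000 ∧
      (C.card = 52416000 →
        IsAntipodalCode C ∧
        IsSphericalDesign 11 C ∧
        IsDistanceInvariant C ∧
        innerProductSet C = {-1, -1 / 2, -1 / 3, -1 / 6, 0, 1 / 6, 1 / 3, 1 / 2} ∧
        ∀ x ∈ C,
          distanceCount C x (-1) = 1 ∧
          distanceCount C x (1 / 2) = 36848 ∧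
          distanceCount C x (-1 / 2) = 36848 ∧
          distanceCount C x (1 / 3) = 1678887 ∧
          distanceCount C x (-1 / 3) = 1678887 ∧
          distanceCount C x (1 / 6) = 12608784 ∧
          distanceCount C x (-1 / 6) = 12608784 ∧
          distanceCount C x 0 = 23766960) := by
  have h3 : ∑ x ∈ C, ∑ y ∈ C, gegenbauer 48 3 (inner ℝ x y) = 0 := by
    rcases h with h | h
    · exact h.sum_gegenbauer_eq_zero_of_odd (by decide)
    · exact h.sum_gegenbauer_eq_zero_of_odd (by decide) le_rfl
  obtain ⟨hle, heq⟩ := card_le_and_of_card_eq hC hI h3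
  refine ⟨hle, fun hN => ?_⟩
  obtain ⟨hS, hO⟩ := heq hN
  have hne : C.Nonempty := Finset.card_pos.1 (by omega)
  have hcount := fun x (hx : x ∈ C) => distanceCount_of_optimal hC hO hN hS hx
  have hneg : ∀ x ∈ C, -x ∈ C := fun x hx => by
    -- A unit vector with inner product `-1` with `x` must be `-x`.
    obtain ⟨y, hy⟩ := Finset.card_pos.1 (show 0 < distanceCount C x (-1) by
      rw [(hcount x hx).1]; exact one_pos)
    rw [Finset.mem_filter] at hy
    have hxy := (inner_eq_neg_one_iff_of_norm_eq_one (hC.norm_eq hx) (hC.norm_eq hy.1)).1 hy.2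
    rw [hxy, neg_neg]
    exact hy.1
  have hmem : ∀ x ∈ C, ∀ t : ℝ, t ≠ 1 → 0 < distanceCount C x t → t ∈ innerProductSet C :=
    fun x hx t ht hpos => by
      obtain ⟨y, hy⟩ := Finset.card_pos.1 hpos
      rw [Finset.mem_filter] at hy
      refine ⟨x, hx, y, hy.1, ?_, hy.2⟩
      rintro rfl
      rw [real_inner_self_eq_norm_sq, hC.norm_eq hx, one_pow] at hy
      exact ht hy.2.symm
  refine ⟨?_, isSphericalDesign_of_sum_gegenbauer (by norm_num) hC hne hS, ?_, ?_, hcount⟩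
  · ext x
    exact ⟨fun hx => hneg x hx, fun hx => by simpa using hneg (-x) hx⟩
  · intro x hx y hy t ht
    obtain ⟨a1, a2, a3, a4, a5, a6, a7, a8⟩ := hcount x hx
    obtain ⟨b1, b2, b3, b4, b5, b6, b7, b8⟩ := hcount y hy
    have ht' := hO ht
    simp only [optimalInnerProducts, Set.mem_insert_iff, Set.mem_singleton_iff] at ht'
    rcases ht' with rfl | rfl | rfl | rfl | rfl | rfl | rfl | rfl
    · rw [a1, b1]
    · rw [a3, b3]
    · rw [a5, b5]
    · rw [a7, b7]
    · rw [a8, b8]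
    · rw [a6, b6]
    · rw [a4, b4]
    · rw [a2, b2]
  · refine Set.Subset.antisymm hO fun t ht => ?_
    obtain ⟨x, hx⟩ := hne
    obtain ⟨a1, a2, a3, a4, a5, a6, a7, a8⟩ := hcount x hx
    simp only [Set.mem_insert_iff, Set.mem_singleton_iff] at ht
    rcases ht with rfl | rfl | rfl | rfl | rfl | rfl | rfl | rfl <;>
      exact hmem x hx _ (by norm_num) (by omega)
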